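/- Let $M$ be a smooth manifold (connected, Hausdorff, second countable) of dimension $n\ge 3$, and let $F:TM\to\mathbb R$ be a Finsler function: $F$ is smooth on the slit tangent bundle $\mathring TM=TM\setminus o(M)$, $F(\lambda v)=\lambda F(v)$ for $\lambda\ge 0$, and the metric tensor $g=\tfrac12\nabla^{\mathsf v}\nabla^{\mathsf v}F^2$ is fibrewise non-degenerate on $\mathring TM$. Here $\nabla^{\mathsf v}$ is the vertical (fibre) derivative, and all tensors are tensors along $\mathring TM\to M$, i.e. sections $\widetilde X,\widetilde Y,\dots$ are smooth maps $v\mapsto\widetilde X(v)\in T_{\tau(v)}M$ ($v\in\mathring TM$, $\tau:TM\to M$ the projection); $\delta(v)=v$ is the canonical section, $\mathbf i(v,w)=\frac{d}{dt}\big|_{0}(v+tw)$ the vertical lift, $\mathbf j(v,\xi)=\tau_*\xi$, and $\mathbf J=\mathbf i\circ\mathbf j$. Put $E=\tfrac12F^2$ and let $S$ be the canonical spray, the vector field on $\mathring TM$ determined by $i_S\,d(dE\circ\mathbf J)=-dE$. Let $\mathcal H$ be the associated Ehresmann connection, $\mathcal H(\widehat X)=\tfrac12(X^{\mathsf c}+[X^{\mathsf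 v},S])$ for vector fields $X$ on $M$ ($\widehat X=X\circ\tau$, $X^{\mathsf c}$, $X^{\mathsf v}$ being the basic section and the complete and vertical lifts of $X$); put $\mathbf h=\mathcal H\circ\mathbf j$, $\mathbf v=1-\mathbf h$, $\mathcal V=\mathbf i^{-1}\circ\mathbf v$. Let $\nabla_\xi\widetilde Y=\mathbf j[\mathbf v\xi,\mathcal H\widetilde Y]+\mathcal V[\mathbf h\xi,\mathbf i\widetilde Y]$ be the Berwald derivative, extended to tensors as a derivation, with curvature $R^\nabla$. Define - the Berwald curvature $\mathbf B(\widetilde X,\widetilde Y)\widetilde Z=R^\nabla(\mathbf i\widetilde X,\mathcal H\widetilde Y)\widetilde Z$ and its trace $(\operatorname{tr}\mathbf B)(\widetilde X,\widetilde Y)=\operatorname{tr}\big(\widetilde Z\mapsto\mathbf B(\widetilde Z,\widetilde X)\widetilde Y\big)$; - the Landsberg tensor $\mathbf P(\widetilde X,\widetilde Y,\widetilde Z)=-\tfrac12(\nabla_{\mathcal H\widetilde X}g)(\widetilde Y,\widetilde Z)$; - the Douglas curvature $\mathbf D=\mathbf B-\frac1{n+1}\big(\operatorname{tr}\mathbf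 B\odot\mathbf 1+(\nabla^{\mathsf v}\operatorname{tr}\mathbf B)\otimes\delta\big)$, where $(\alpha\odot\mathbf 1)(\widetilde X,\widetilde Y,\widetilde Z)=\alpha(\widetilde X,\widetilde Y)\widetilde Z+\alpha(\widetilde Y,\widetilde Z)\widetilde X+\alpha(\widetilde Z,\widetilde X)\widetilde Y$ and $\nabla^{\mathsf v}\alpha(\widetilde X,\widetilde Y,\widetilde Z)=(\nabla_{\mathbf i\widetilde X}\alpha)(\widetilde Y,\widetilde Z)$; - the projection $\mathbf p\widetilde X=\widetilde X-\frac{g(\widetilde X,\delta)}{g(\delta,\delta)}\delta$ and the projected Berwald curvature $\mathbf{pB}(\widetilde X,\widetilde Y,\widetilde Z)=\mathbf p\big(\mathbf B(\mathbf p\widetilde X,\mathbf p\widetilde Y)\mathbf p\widetilde Z\big)$. Call $(M,F)$ *p-Berwald* if $\mathbf{pB}=0$, *Berwald* if $\mathbf B=0$, *weakly Berwald* if $\operatorname{tr}\mathbf B=0$, and *Douglas* if $\mathbf D=0$ (identically on $\mathring TM$). Then: 1. $(M,F)$ is p-Berwald if and only if $\mathbf B+\frac1E\,\mathbf P\otimes\delta=0$.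 2. $(M,F)$ is p-Berwald if and only if it is a weakly Berwald Douglas manifold. 3. $(M,F)$ is p-Berwald if and only if it is a Berwald manifold. -/

import Mathlib

open Set VectorField
open scoped Manifold ContDiff

noncomputable section

namespace Finsler

/-! ### Finsler geometry over a chart

`Model n` is `ℝⁿ`.  Over the domain of a chart the tangent bundle is `U × ℝⁿ`, `U ⊆ ℝⁿ` open; its
points are pairs `z = (x, y)`, `x` the position and `y` the direction, and the slit tangent bundle
is the part with `y ≠ 0`.  A section along the slit tangent bundle is a map
`ℝⁿ × ℝⁿ → ℝⁿ`; the constant maps are the coordinate (basic) vector fields.  A vector field on the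
tangent bundle is a map `ℝⁿ × ℝⁿ → ℝⁿ × ℝⁿ`.  All objects below are built from a Finsler
function `f (x, y)`; a tensor is given by its values on constant sections. -/

/-- The model space `ℝⁿ`. -/
abbrev Model (n : ℕ) := EuclideanSpace ℝ (Fin n)

variable {n : ℕ}

/-- The vertical vector field `𝐢 X` of a section `X`. -/
def vertLift (X : Model n × Model n → Model n) : Model n × Model n → Model n × Model n :=
  fun z => (0, X z)

/-- The energy function `E = F² / 2`. -/
def energy (f : Model n × Model n → ℝ) : Model n × Model n → ℝ :=
  fun z => f z ^ 2 / 2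

/-- The metric tensor `g = ½ ∇ᵛ∇ᵛ F²`, i.e. `g (X, Y) = ½ Xᵛ (Yᵛ F²)` on basic fields. -/
def metric (f : Model n × Model n → ℝ) (z : Model n × Model n) (X Y : Model n) : ℝ :=
  (1 / 2) * fderiv ℝ (fun w => fderiv ℝ (fun u => f u ^ 2) w (0, Y)) z (0, X)

/-- The vertical endomorphism `𝐉 (a, b) = (0, a)`. -/
def vertEndo : Model n × Model n →L[ℝ] Model n × Model n :=
  (ContinuousLinearMap.inr ℝ (Model n) (Model n)).comp
    (ContinuousLinearMap.fst ℝ (Model n) (Model n))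

/-- The 1-form `d_𝐉 E = dE ∘ 𝐉`. -/
def dJE (f : Model n × Model n → ℝ) : Model n × Model n → (Model n × Model n →L[ℝ] ℝ) :=
  fun z => (fderiv ℝ (energy f) z).comp vertEndo

/-- The 2-form `d d_𝐉 E`, as the map `ξ ↦ i_ξ d d_𝐉 E`. It is the exterior derivative
`dα (ξ, η) = ξ (α η) - η (α ξ) - α [ξ, η]` of `α = d_𝐉 E`. -/
def ddJE (f : Model n × Model n → ℝ) (z : Model n × Model n) :
    Model n × Model n →L[ℝ] (Model n × Model n →L[ℝ] ℝ) :=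
  fderiv ℝ (dJE f) z - (fderiv ℝ (dJE f) z).flip

/-- The canonical spray: the vector field `S` with `i_S d d_𝐉 E = -dE`
(at points where the metric tensor is nondegenerate, `d d_𝐉 E` is invertible). -/
def spray (f : Model n × Model n → ℝ) : Model n × Model n → Model n × Model n :=
  fun z => (ddJE f z).inverse (-(fderiv ℝ (energy f) z))

/-- The Ehresmann connection `ℋ` associated with the canonical spray, at the point `z`:
`ℋ (X) = ½ (Xᶜ + [Xᵛ, S])` for a coordinate field `X`, whose complete lift `Xᶜ` is `(X, 0)`. -/
def hor (f : Model n × Model n → ℝ) (z : Model n × Model n) (X : Model n) : Model n × Model n :=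
  (1 / 2 : ℝ) • ((X, 0) + lieBracket ℝ (vertLift fun _ => X) (spray f) z)

/-- The horizontal vector field `ℋ X` of a section `X`. -/
def horLift (f : Model n × Model n → ℝ) (X : Model n × Model n → Model n) :
    Model n × Model n → Model n × Model n :=
  fun z => hor f z (X z)

/-- The vertical map `𝒱 = 𝐢⁻¹ ∘ (1 - ℋ ∘ 𝐣)`, where `𝐣 (a, b) = a`. -/
def vert (f : Model n × Model n → ℝ) (z : Model n × Model n) (ξ : Model n × Model n) : Model n :=
  (ξ - hor f z ξ.1).2

/-- The Berwald derivative `∇_ξ Y = 𝐣 [𝐯 ξ, ℋ Y] + 𝒱 [𝐡 ξ, 𝐢 Y]` of a section `Y` in the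
direction of a vector field `ξ`, where `𝐡 = ℋ ∘ 𝐣` and `𝐯 = 1 - 𝐡`. -/
def nabla (f : Model n × Model n → ℝ) (ξ : Model n × Model n → Model n × Model n)
    (Y : Model n × Model n → Model n) : Model n × Model n → Model n :=
  fun z =>
    (lieBracket ℝ (fun w => ξ w - hor f w (ξ w).1) (horLift f Y) z).1 +
      vert f z (lieBracket ℝ (fun w => hor f w (ξ w).1) (vertLift Y) z)

/-- The Berwald derivative of a type `(0, 2)` tensor, evaluated on coordinate fields `Y`, `Z`:
`(∇_ξ A) (Y, Z) = ξ (A (Y, Z)) - A (∇_ξ Y, Z) - A (Y, ∇_ξ Z)`. -/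
def nablaTensor (f : Model n × Model n → ℝ) (ξ : Model n × Model n → Model n × Model n)
    (A : Model n × Model n → Model n → Model n → ℝ) (z : Model n × Model n)
    (Y Z : Model n) : ℝ :=
  fderiv ℝ (fun w => A w Y Z) z (ξ z) - A z (nabla f ξ (fun _ => Y) z) Z -
    A z Y (nabla f ξ (fun _ => Z) z)

/-- The Berwald curvature `𝐁 (X, Y) Z = R^∇ (𝐢 X, ℋ Y) Z`, with `R^∇` the curvature
`R^∇ (ξ, η) Z = ∇_ξ ∇_η Z - ∇_η ∇_ξ Z - ∇_[ξ, η] Z` of the Berwald derivative. -/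
def berwald (f : Model n × Model n → ℝ) (z : Model n × Model n) (X Y Z : Model n) : Model n :=
  nabla f (vertLift fun _ => X) (nabla f (horLift f fun _ => Y) fun _ => Z) z -
    nabla f (horLift f fun _ => Y) (nabla f (vertLift fun _ => X) fun _ => Z) z -
    nabla f (lieBracket ℝ (vertLift fun _ => X) (horLift f fun _ => Y)) (fun _ => Z) z

/-- The trace `(tr 𝐁) (X, Y) = tr (Z ↦ 𝐁 (Z, X) Y)`. -/
def trBerwald (f : Model n × Model n → ℝ) (z : Model n × Model n) (X Y : Model n) : ℝ :=
  ∑ i : Fin n, (berwald f z (EuclideanSpace.single i 1) X Y) i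

/-- The Landsberg tensor `𝐏 = -½ ∇ʰ g`, `∇ʰ g (X, Y, Z) = (∇_{ℋ X} g) (Y, Z)`. -/
def landsberg (f : Model n × Model n → ℝ) (z : Model n × Model n) (X Y Z : Model n) : ℝ :=
  -(1 / 2) * nablaTensor f (horLift f fun _ => X) (metric f) z Y Z

/-- The Douglas curvature `𝐃 = 𝐁 - 1/(n+1) (tr 𝐁 ⊙ 𝟏 + (∇ᵛ tr 𝐁) ⊗ δ)`, where `δ (x, y) = y`,
`⊙` is the symmetric product without numerical factor, and
`∇ᵛ tr 𝐁 (X, Y, Z) = (∇_{𝐢 X} tr 𝐁) (Y, Z)`. -/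
def douglas (f : Model n × Model n → ℝ) (z : Model n × Model n) (X Y Z : Model n) : Model n :=
  berwald f z X Y Z - (1 / ((n : ℝ) + 1)) •
    ((trBerwald f z X Y • Z + trBerwald f z Y Z • X + trBerwald f z Z X • Y) +
      nablaTensor f (vertLift fun _ => X) (trBerwald f) z Y Z • z.2)

/-- The orthogonal projection `𝐩 X = X - (g (X, δ) / g (δ, δ)) δ` along `δ`. -/
def proj (f : Model n × Model n → ℝ) (z : Model n × Model n) (X : Model n) : Model n :=
  X - (metric f z X z.2 / metric f z z.2 z.2) • z.2

/-- The projected Berwald curvature `𝐩𝐁 (X, Y, Z) = 𝐩 (𝐁 (𝐩 X, 𝐩 Y) 𝐩 Z)`. -/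
def projBerwald (f : Model n × Model n → ℝ) (z : Model n × Model n) (X Y Z : Model n) : Model n :=
  proj f z (berwald f z (proj f z X) (proj f z Y) (proj f z Z))

/-! ### Finsler manifolds -/

variable {M : Type*} [TopologicalSpace M] [ChartedSpace (Model n) M] [IsManifold (𝓡 n) ∞ M]

/-- The expression `(x, y) ↦ F (d(φ⁻¹)_x y)` of a function `F` on `TM` in a chart `φ` of `M`. -/
def chartExpr (F : TangentBundle (𝓡 n) M → ℝ) (φ : OpenPartialHomeomorph M (Model n)) :
    Model n × Model n → ℝ :=
  fun z => F ⟨φ.symm z.1, mfderiv (𝓡 n) (𝓡 n) φ.symm z.1 z.2⟩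

/-- The property `P` of the local expression of `F` holds at all points `(x, y)`, `y ≠ 0`, of the
slit tangent bundle, in all charts of the (maximal) smooth atlas. -/
def OnSlit (F : TangentBundle (𝓡 n) M → ℝ)
    (P : (Model n × Model n → ℝ) → Model n × Model n → Prop) : Prop :=
  ∀ φ ∈ IsManifold.maximalAtlas (𝓡 n) ∞ M, ∀ x ∈ φ.target, ∀ y : Model n, y ≠ 0 →
    P (chartExpr F φ) (x, y)

/-- `F : TM → ℝ` is a Finsler function. -/
structure IsFinslerFunction (F : TangentBundle (𝓡 n) M → ℝ) : Prop where
  /-- `F` is smooth on the slit tangent bundle. -/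
  smooth : ContMDiffOn (𝓡 n).tangent 𝓘(ℝ, ℝ) ∞ F {v : TangentBundle (𝓡 n) M | v.2 ≠ 0}
  /-- `F` is positive-homogeneous of degree one. -/
  homogeneous : ∀ (p : M) (v : TangentSpace (𝓡 n) p) (c : ℝ), 0 ≤ c →
    F ⟨p, c • v⟩ = c * F ⟨p, v⟩
  /-- The metric tensor is nondegenerate. -/
  nondegenerate : OnSlit F fun f z => ∀ X, (∀ Y, metric f z X Y = 0) → X = 0

/-- Berwald manifolds: `𝐁 = 0`. -/
def IsBerwald (F : TangentBundle (𝓡 n) M → ℝ) : Prop :=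
  OnSlit F fun f z => ∀ X Y Z, berwald f z X Y Z = 0

/-- Weakly Berwald manifolds: `tr 𝐁 = 0`. -/
def IsWeaklyBerwald (F : TangentBundle (𝓡 n) M → ℝ) : Prop :=
  OnSlit F fun f z => ∀ X Y, trBerwald f z X Y = 0

/-- Douglas manifolds: `𝐃 = 0`. -/
def IsDouglas (F : TangentBundle (𝓡 n) M → ℝ) : Prop :=
  OnSlit F fun f z => ∀ X Y Z, douglas f z X Y Z = 0

/-- p-Berwald manifolds: the projected Berwald curvature `𝐩𝐁` vanishes. -/
def IsPBerwald (F : TangentBundle (𝓡 n) M → ℝ) : Prop :=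
  OnSlit F fun f z => ∀ X Y Z, projBerwald f z X Y Z = 0

end Finsler

end

/-! The heart of the matter is local. In a chart the canonical spray is `S = (y, H)`, where `H` is
homogeneous of degree 2 in `y`, and the Berwald curvature is `B = -½ ∂³H`, a third vertical
derivative (`berwald_eq`). Hence `B` and its vertical derivative are totally symmetric
(`fderiv_berwald_comm`), and `B` vanishes when one argument is `δ` (`berwald_direction`).

Consequently the projections on the arguments of `pB` have no effect. The outer projection is
governed by `g(δ, δ) = 2E` and `g(B(X, Y)Z, δ) = -2P(X, Y, Z)`, the latter obtained by
differentiating twice vertically the fact that `E` is constant along horizontal fields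
(`metric_berwald_direction`). So `pB = B + (1/E) P ⊗ δ` always (`projBerwald_eq`), which gives the
first equivalence.

If `pB = 0`, then `B = λ ⊗ δ` for some scalar `λ`. A vertical derivative along `V` gives `(∇_V λ)(X,
Y, Z) y + λ(X, Y, Z) V`, which is symmetric in `V` and `X`. As `n ≥ 3`, there are a `V` outside the
span of `y` and `X` and a linear form that kills `y` and `X` but not `V`; applying it leaves `λ(X,
Y, Z) = 0`. Hence `B = 0` (`berwald_eq_zero_of_projBerwald_eq_zero`). The second equivalence follows
from the third: `D = B` as soon as `tr B = 0`. -/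

noncomputable section

namespace Finsler

variable {n : ℕ}

/-! ### Directional derivatives on the slit tangent bundle of an open set -/

/-- The slit tangent bundle of `U ⊆ ℝⁿ`. -/
def slit (U : Set (Model n)) : Set (Model n × Model n) := {z | z.1 ∈ U ∧ z.2 ≠ 0}

theorem isOpen_slit {U : Set (Model n)} (hU : IsOpen U) : IsOpen (slit U) :=
  (hU.preimage continuous_fst).inter (isOpen_ne.preimage continuous_snd)

section Calculus

variable {V W : Type*} [NormedAddCommGroup V] [NormedSpace ℝ V] [NormedAddCommGroup W]
  [NormedSpace ℝ W] {Ω : Set V} {g : V → W} {z : V}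

theorem contDiffOn_fderiv_apply (hΩ : IsOpen Ω) (hg : ContDiffOn ℝ ∞ g Ω) {ξ : V → V}
    (hξ : ContDiffOn ℝ ∞ ξ Ω) : ContDiffOn ℝ ∞ (fun z => fderiv ℝ g z (ξ z)) Ω :=
  (hg.fderiv_of_isOpen hΩ (by simp)).clm_apply hξ

theorem differentiableAt_of_contDiffOn (hΩ : IsOpen Ω) (hg : ContDiffOn ℝ ∞ g Ω) (hz : z ∈ Ω) :
    DifferentiableAt ℝ g z :=
  (hg.differentiableOn (by simp)).differentiableAt (hΩ.mem_nhds hz)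

theorem fderiv_congr_of_isOpen (hΩ : IsOpen Ω) {h : V → W} (hgh : ∀ w ∈ Ω, g w = h w)
    (hz : z ∈ Ω) : fderiv ℝ g z = fderiv ℝ h z :=
  Filter.EventuallyEq.fderiv_eq (Filter.eventually_of_mem (hΩ.mem_nhds hz) hgh)

/-- The product rule for the derivative of `g` along a vector field `ξ`. -/
theorem fderiv_fderiv_apply (hΩ : IsOpen Ω) (hg : ContDiffOn ℝ ∞ g Ω) (hz : z ∈ Ω) {ξ : V → V}
    (hξ : DifferentiableAt ℝ ξ z) (η : V) :
    fderiv ℝ (fun w => fderiv ℝ g w (ξ w)) z η =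
      fderiv ℝ (fun w => fderiv ℝ g w (ξ z)) z η + fderiv ℝ g z (fderiv ℝ ξ z η) := by
  have h := (differentiableAt_of_contDiffOn hΩ (hg.fderiv_of_isOpen (m := ∞) hΩ (by simp))
    hz).hasFDerivAt
  rw [(h.clm_apply hξ.hasFDerivAt).fderiv, (h.clm_apply (hasFDerivAt_const (ξ z) z)).fderiv]
  simp [add_comm]

theorem fderiv_fderiv_const (hΩ : IsOpen Ω) (hg : ContDiffOn ℝ ∞ g Ω) (hz : z ∈ Ω) (ξ η : V) :
    fderiv ℝ (fun w => fderiv ℝ g w ξ) z η = fderiv ℝ (fderiv ℝ g) z η ξ := by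
  have h := (differentiableAt_of_contDiffOn hΩ (hg.fderiv_of_isOpen (m := ∞) hΩ (by simp))
    hz).hasFDerivAt
  rw [(h.clm_apply (hasFDerivAt_const ξ z)).fderiv]
  simp

theorem fderiv_fderiv_comm (hΩ : IsOpen Ω) (hg : ContDiffOn ℝ ∞ g Ω) (hz : z ∈ Ω) (ξ η : V) :
    fderiv ℝ (fun w => fderiv ℝ g w ξ) z η = fderiv ℝ (fun w => fderiv ℝ g w η) z ξ := by
  rw [fderiv_fderiv_const hΩ hg hz, fderiv_fderiv_const hΩ hg hz]
  exact ((hg.contDiffAt (hΩ.mem_nhds hz)).isSymmSndFDerivAt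
    (by simpa using WithTop.coe_le_coe.2 (le_top : (2 : ℕ∞) ≤ ⊤))) η ξ

end Calculus

/-! ### Euler's relation and its behaviour under differentiation -/

section Euler

variable {W : Type*} [NormedAddCommGroup W] [NormedSpace ℝ W] {Ω : Set (Model n × Model n)}
  {g : Model n × Model n → W} {k : ℝ}

/-- Euler's relation: `g` is homogeneous of degree `k` in the direction. -/
def EulerOn (k : ℝ) (g : Model n × Model n → W) (Ω : Set (Model n × Model n)) : Prop :=
  ∀ z ∈ Ω, fderiv ℝ g z (0, z.2) = k • g z

/-- The vertical projection `(x, y) ↦ (0, y)`. -/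
def vertProj : Model n × Model n →L[ℝ] Model n × Model n :=
  (ContinuousLinearMap.inr ℝ (Model n) (Model n)).comp
    (ContinuousLinearMap.snd ℝ (Model n) (Model n))

/-- Differentiate Euler's relation along `(X, Y)` and commute the second derivatives; the correction
term comes from differentiating the Euler field `(0, y)` itself. Horizontal derivatives thus keep
the degree and vertical ones lower it by one. -/
theorem EulerOn.fderiv_apply (hΩ : IsOpen Ω) (hg : ContDiffOn ℝ ∞ g Ω) (h : EulerOn k g Ω)
    (X Y : Model n) {z : Model n × Model n} (hz : z ∈ Ω) :
    fderiv ℝ (fun w => fderiv ℝ g w (X, Y)) z (0, z.2) =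
      k • fderiv ℝ g z (X, Y) - fderiv ℝ g z (0, Y) := by
  have h1 := fderiv_congr_of_isOpen hΩ h hz
  have h2 := fderiv_fderiv_apply hΩ hg hz (ξ := vertProj) vertProj.differentiableAt (X, Y)
  have h3 : fderiv ℝ (fun w => fderiv ℝ g w (vertProj w)) z (X, Y) = k • fderiv ℝ g z (X, Y) := by
    have : (fun w => fderiv ℝ g w (vertProj w)) =
      fun w : Model n × Model n => fderiv ℝ g w (0, w.2) := rfl
    rw [this, h1, fderiv_fun_const_smul (differentiableAt_of_contDiffOn hΩ hg hz)]; rfl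
  rw [h3] at h2
  rw [fderiv_fderiv_comm hΩ hg hz, h2, ContinuousLinearMap.fderiv]
  simp [vertProj]

theorem EulerOn.fderiv_horizontal (hΩ : IsOpen Ω) (hg : ContDiffOn ℝ ∞ g Ω) (h : EulerOn k g Ω)
    (X : Model n) : EulerOn k (fun w => fderiv ℝ g w (X, 0)) Ω := fun z hz => by
  have h0 : ((0 : Model n), (0 : Model n)) = 0 := rfl
  rw [h.fderiv_apply hΩ hg X 0 hz, h0, map_zero, sub_zero]

theorem EulerOn.fderiv_vertical (hΩ : IsOpen Ω) (hg : ContDiffOn ℝ ∞ g Ω) (h : EulerOn k g Ω)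
    (Y : Model n) : EulerOn (k - 1) (fun w => fderiv ℝ g w (0, Y)) Ω := fun z hz => by
  rw [h.fderiv_apply hΩ hg 0 Y hz, sub_smul, one_smul]

end Euler

/-! ### Local Finsler functions -/

/-- `f` is a Finsler function on the tangent bundle of the open set `U ⊆ ℝⁿ`. -/
structure IsLocalFinsler (U : Set (Model n)) (f : Model n × Model n → ℝ) : Prop where
  isOpen : IsOpen U
  smooth : ContDiffOn ℝ ∞ f (slit U)
  homogeneous : ∀ x ∈ U, ∀ (y : Model n) (c : ℝ), 0 ≤ c → f (x, c • y) = c * f (x, y)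
  nondegenerate : ∀ z ∈ slit U, ∀ X, (∀ Y, metric f z X Y = 0) → X = 0

namespace IsLocalFinsler

variable {U : Set (Model n)} {f : Model n × Model n → ℝ} {z : Model n × Model n}

theorem isOpen_slit (h : IsLocalFinsler U f) : IsOpen (slit U) := Finsler.isOpen_slit h.isOpen

theorem contDiffOn_energy (h : IsLocalFinsler U f) : ContDiffOn ℝ ∞ (energy f) (slit U) :=
  (h.smooth.pow 2).div_const 2

theorem eulerOn_energy (h : IsLocalFinsler U f) : EulerOn 2 (energy f) (slit U) := by
  intro z hz
  have hd := (differentiableAt_of_contDiffOn h.isOpen_slit h.contDiffOn_energy hz).hasFDerivAt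
  have hc : HasDerivAt (fun t : ℝ => ((z.1, t • z.2) : Model n × Model n)) (0, z.2) 1 := by
    simpa using (hasDerivAt_const (1 : ℝ) z.1).prodMk ((hasDerivAt_id (1 : ℝ)).smul_const z.2)
  have h1 : HasDerivAt (fun t : ℝ => energy f (z.1, t • z.2))
      (fderiv ℝ (energy f) z (0, z.2)) 1 := by
    have hd' : HasFDerivAt (energy f) (fderiv ℝ (energy f) z) (z.1, (1 : ℝ) • z.2) := by
      simpa using hd
    exact hd'.comp_hasDerivAt (1 : ℝ) hc
  have h2 : HasDerivAt (fun t : ℝ => t ^ 2 * energy f z) (2 * energy f z) 1 := by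
    simpa using (hasDerivAt_pow 2 (1 : ℝ)).mul_const (energy f z)
  refine h1.unique (h2.congr_of_eventuallyEq ?_)
  filter_upwards [lt_mem_nhds (zero_lt_one : (0 : ℝ) < 1)] with t ht
  simp only [energy, h.homogeneous z.1 hz.1 z.2 t ht.le]
  ring

theorem metric_eq (h : IsLocalFinsler U f) (hz : z ∈ slit U) (X Y : Model n) :
    metric f z X Y = fderiv ℝ (fun w => fderiv ℝ (energy f) w (0, Y)) z (0, X) := by
  have h1 : ∀ w ∈ slit U,
      fderiv ℝ (fun u => f u ^ 2) w (0, Y) = 2 * fderiv ℝ (energy f) w (0, Y) := by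
    intro w hw
    have : (fun u => f u ^ 2) = fun u => (2 : ℝ) • energy f u := by
      funext u; simp only [energy, smul_eq_mul]; ring
    rw [this, fderiv_fun_const_smul
      (differentiableAt_of_contDiffOn h.isOpen_slit h.contDiffOn_energy hw)]
    rfl
  rw [metric, fderiv_congr_of_isOpen h.isOpen_slit h1 hz, fderiv_const_mul
    (differentiableAt_of_contDiffOn h.isOpen_slit
      (contDiffOn_fderiv_apply h.isOpen_slit h.contDiffOn_energy contDiffOn_const) hz)]
  simp

theorem metric_comm (h : IsLocalFinsler U f) (hz : z ∈ slit U) (X Y : Model n) :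
    metric f z X Y = metric f z Y X := by
  rw [h.metric_eq hz, h.metric_eq hz, fderiv_fderiv_comm h.isOpen_slit h.contDiffOn_energy hz]

theorem metric_direction (h : IsLocalFinsler U f) (hz : z ∈ slit U) (X : Model n) :
    metric f z X z.2 = fderiv ℝ (energy f) z (0, X) := by
  rw [h.metric_comm hz, h.metric_eq hz,
    h.eulerOn_energy.fderiv_vertical h.isOpen_slit h.contDiffOn_energy X z hz]
  norm_num

theorem metric_direction_direction (h : IsLocalFinsler U f) (hz : z ∈ slit U) :
    metric f z z.2 z.2 = 2 * energy f z := by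
  rw [h.metric_direction hz, h.eulerOn_energy z hz, smul_eq_mul]

/-- No definiteness is assumed: `dE = F dF` vanishes wherever `F` does, so `g(δ, ·)` would vanish
there, against nondegeneracy. Division by `E` and by `g(δ, δ)` is therefore legitimate. -/
theorem energy_ne_zero (h : IsLocalFinsler U f) (hz : z ∈ slit U) : energy f z ≠ 0 := by
  intro h0
  have hf : f z = 0 := by simpa [energy] using h0
  refine hz.2 (h.nondegenerate z hz z.2 fun Y => ?_)
  rw [h.metric_comm hz, h.metric_direction hz]
  have hd := (differentiableAt_of_contDiffOn h.isOpen_slit h.smooth hz).hasFDerivAt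
  have he : HasFDerivAt (fun u => f u ^ 2 / 2)
    ((2 : ℝ)⁻¹ • ((2 : ℝ) * f z ^ 1) • fderiv ℝ f z) z := by
    simpa [div_eq_inv_mul] using (hd.pow 2).const_mul (2 : ℝ)⁻¹
  have : energy f = fun u => f u ^ 2 / 2 := rfl
  rw [this, he.fderiv, hf]
  simp

end IsLocalFinsler

/-! ### Linear algebra for inverting the two-form `dd_J E` -/

section Linear

variable {V W : Type*} [NormedAddCommGroup V] [NormedSpace ℝ V] [NormedAddCommGroup W]
  [NormedSpace ℝ W]

theorem contDiff_flip {k : WithTop ℕ∞} :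
    ContDiff ℝ k (fun L : V →L[ℝ] V →L[ℝ] W => L.flip) :=
  (IsLinearMap.with_bound (f := fun L : V →L[ℝ] V →L[ℝ] W => L.flip)
    ⟨fun _ _ => rfl, fun _ _ => rfl⟩ 1
    fun L => by rw [ContinuousLinearMap.opNorm_flip, one_mul]).contDiff

theorem isInvertible_of_injective [FiniteDimensional ℝ V] [FiniteDimensional ℝ W] {L : V →L[ℝ] W}
    (hL : Function.Injective L) (hfin : Module.finrank ℝ V = Module.finrank ℝ W) :
    L.IsInvertible :=
  ⟨(LinearEquiv.ofInjectiveOfFinrankEq L.toLinearMap hL hfin).toContinuousLinearEquiv, by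
    ext; rfl⟩

theorem contDiffAt_inverse [CompleteSpace V] {k : WithTop ℕ∞} {L : V →L[ℝ] W}
    (hL : L.IsInvertible) : ContDiffAt ℝ k ContinuousLinearMap.inverse L := by
  obtain ⟨e, rfl⟩ := hL
  exact contDiffAt_map_inverse e

end Linear

namespace IsLocalFinsler

variable {U : Set (Model n)} {f : Model n × Model n → ℝ} {z : Model n × Model n}

/-! ### The canonical spray -/

theorem hessian_comm (h : IsLocalFinsler U f) (hz : z ∈ slit U) (ξ η : Model n × Model n) :
    fderiv ℝ (fderiv ℝ (energy f)) z ξ η = fderiv ℝ (fderiv ℝ (energy f)) z η ξ := by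
  rw [← fderiv_fderiv_const h.isOpen_slit h.contDiffOn_energy hz,
    ← fderiv_fderiv_const h.isOpen_slit h.contDiffOn_energy hz,
    fderiv_fderiv_comm h.isOpen_slit h.contDiffOn_energy hz]

theorem metric_eq_hessian (h : IsLocalFinsler U f) (hz : z ∈ slit U) (X Y : Model n) :
    metric f z X Y = fderiv ℝ (fderiv ℝ (energy f)) z (0, X) (0, Y) := by
  rw [h.metric_eq hz, fderiv_fderiv_const h.isOpen_slit h.contDiffOn_energy hz]

theorem contDiffOn_dJE (h : IsLocalFinsler U f) : ContDiffOn ℝ ∞ (dJE f) (slit U) :=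
  (h.contDiffOn_energy.fderiv_of_isOpen h.isOpen_slit (by simp)).clm_comp contDiffOn_const

theorem contDiffOn_ddJE (h : IsLocalFinsler U f) : ContDiffOn ℝ ∞ (ddJE f) (slit U) := by
  have h1 : ContDiffOn ℝ ∞ (fderiv ℝ (dJE f)) (slit U) :=
    h.contDiffOn_dJE.fderiv_of_isOpen h.isOpen_slit (by simp)
  exact h1.sub (contDiff_flip.comp_contDiffOn h1)

theorem fderiv_dJE_apply (h : IsLocalFinsler U f) (hz : z ∈ slit U) (ξ η : Model n × Model n) :
    fderiv ℝ (dJE f) z ξ η = fderiv ℝ (fderiv ℝ (energy f)) z ξ (0, η.1) := by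
  have h1 := (differentiableAt_of_contDiffOn h.isOpen_slit
    (h.contDiffOn_energy.fderiv_of_isOpen (m := ∞) h.isOpen_slit (by simp)) hz).hasFDerivAt
  have h2 : HasFDerivAt (dJE f) _ z := h1.clm_comp (hasFDerivAt_const vertEndo z)
  rw [h2.fderiv]
  simp [vertEndo]

theorem ddJE_apply (h : IsLocalFinsler U f) (hz : z ∈ slit U) (ξ η : Model n × Model n) :
    ddJE f z ξ η = fderiv ℝ (fderiv ℝ (energy f)) z ξ (0, η.1) -
      fderiv ℝ (fderiv ℝ (energy f)) z η (0, ξ.1) := by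
  simp only [ddJE, sub_apply, ContinuousLinearMap.flip_apply,
    h.fderiv_dJE_apply hz]

/-- The two-form is block triangular with blocks `±g`: vertical test vectors detect the first
component, and then horizontal ones detect the second. -/
theorem ddJE_injective (h : IsLocalFinsler U f) (hz : z ∈ slit U) :
    Function.Injective (ddJE f z) := by
  rw [injective_iff_map_eq_zero]
  rintro ⟨a, b⟩ hab
  have ha : a = 0 := h.nondegenerate z hz a fun d => by
    have := DFunLike.congr_fun hab ((0, d) : Model n × Model n)
    rw [h.ddJE_apply hz] at this
    rw [h.metric_comm hz, h.metric_eq_hessian hz]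
    have h0 : ((0 : Model n), (0 : Model n)) = 0 := rfl
    simpa [h0] using this
  subst ha
  have hb : b = 0 := h.nondegenerate z hz b fun c => by
    have := DFunLike.congr_fun hab ((c, 0) : Model n × Model n)
    rw [h.ddJE_apply hz] at this
    rw [h.metric_eq_hessian hz]
    have h0 : ((0 : Model n), (0 : Model n)) = 0 := rfl
    simpa [h0] using this
  rw [hb]; rfl

theorem isInvertible_ddJE (h : IsLocalFinsler U f) (hz : z ∈ slit U) :
    (ddJE f z).IsInvertible := by
  refine isInvertible_of_injective (h.ddJE_injective hz) ?_
  rw [← (LinearMap.toContinuousLinearMap (𝕜 := ℝ) (E := Model n × Model n) (F' := ℝ)).finrank_eq]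
  exact (Subspace.dual_finrank_eq (K := ℝ) (V := Model n × Model n)).symm

theorem ddJE_spray (h : IsLocalFinsler U f) (hz : z ∈ slit U) :
    ddJE f z (spray f z) = -fderiv ℝ (energy f) z :=
  (h.isInvertible_ddJE hz).self_apply_inverse _

theorem contDiffOn_spray (h : IsLocalFinsler U f) : ContDiffOn ℝ ∞ (spray f) (slit U) := by
  have h1 : ContDiffOn ℝ ∞ (fun z => (ddJE f z).inverse) (slit U) := fun z hz =>
    (contDiffAt_inverse (h.isInvertible_ddJE hz)).comp_contDiffWithinAt z (h.contDiffOn_ddJE z hz)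
  exact h1.clm_apply (h.contDiffOn_energy.fderiv_of_isOpen h.isOpen_slit (by simp)).neg

theorem spray_fst (h : IsLocalFinsler U f) (hz : z ∈ slit U) : (spray f z).1 = z.2 := by
  rw [← sub_eq_zero]
  refine h.nondegenerate z hz _ fun d => ?_
  have := DFunLike.congr_fun (h.ddJE_spray hz) ((0, d) : Model n × Model n)
  rw [h.ddJE_apply hz] at this
  have h2 := h.metric_direction hz d
  rw [h.metric_eq_hessian hz] at h2
  have h3 : ((0 : Model n), (spray f z).1 - z.2) = (0, (spray f z).1) - (0, z.2) := by simp
  have h0 : ((0 : Model n), (0 : Model n)) = 0 := rfl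
  simp only [h0, map_zero, zero_sub, neg_apply, neg_inj] at this
  rw [h.metric_comm hz, h.metric_eq_hessian hz, h3, map_sub, this, h2, sub_self]

/-- The Euler–Lagrange equation. -/
theorem hessian_spray (h : IsLocalFinsler U f) (hz : z ∈ slit U) (X : Model n) :
    fderiv ℝ (fderiv ℝ (energy f)) z (spray f z) (0, X) = fderiv ℝ (energy f) z (X, 0) := by
  have h1 := DFunLike.congr_fun (h.ddJE_spray hz) ((X, 0) : Model n × Model n)
  -- Homogeneity evaluates the second Hessian term of `dd_J E (S, (X, 0))`, namely the one in the
  -- directions `(X, 0)` and `(0, y)`, as `2 dE(X, 0)`.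
  have h2 := h.eulerOn_energy.fderiv_horizontal h.isOpen_slit h.contDiffOn_energy X z hz
  rw [fderiv_fderiv_const h.isOpen_slit h.contDiffOn_energy hz] at h2
  rw [h.ddJE_apply hz, h.spray_fst hz, h.hessian_comm hz (X, 0), h2,
    neg_apply] at h1
  simp only [smul_eq_mul] at h1
  linarith

/-- The energy is constant along the spray. -/
theorem fderiv_energy_spray (h : IsLocalFinsler U f) (hz : z ∈ slit U) :
    fderiv ℝ (energy f) z (spray f z) = 0 := by
  -- The Hessian of `E` on `S` and `(0, y)` is computed twice, by the Euler–Lagrange equation and by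
  -- Euler's relation; comparison gives `dE(S) = 0`.
  have h1 := h.hessian_spray hz z.2
  have h2 := h.eulerOn_energy.fderiv_apply h.isOpen_slit h.contDiffOn_energy
    (spray f z).1 (spray f z).2 hz
  rw [fderiv_fderiv_const h.isOpen_slit h.contDiffOn_energy hz] at h2
  have h3 : fderiv ℝ (energy f) z (spray f z) =
      fderiv ℝ (energy f) z (z.2, 0) + fderiv ℝ (energy f) z (0, (spray f z).2) := by
    rw [← map_add]
    congr 1
    ext1 <;> simp [h.spray_fst hz]
  rw [h.hessian_comm hz] at h1
  simp only [Prod.mk.eta, smul_eq_mul] at h2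
  linarith

/-! ### The spray coefficients -/

/-- The vertical part of the canonical spray. -/
def _root_.Finsler.sprayCoeff (f : Model n × Model n → ℝ) (z : Model n × Model n) : Model n :=
  (spray f z).2

theorem spray_eq (h : IsLocalFinsler U f) (hz : z ∈ slit U) :
    spray f z = (z.2, sprayCoeff f z) :=
  Prod.ext (h.spray_fst hz) rfl

theorem contDiffOn_sprayCoeff (h : IsLocalFinsler U f) :
    ContDiffOn ℝ ∞ (sprayCoeff f) (slit U) :=
  contDiff_snd.comp_contDiffOn h.contDiffOn_spray

/-- Differentiating the Euler–Lagrange equation along the Euler field `(0, y)` gives `g(∂H(0, y) -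
2H, X) = 0` for all `X`, where `H` is the spray coefficient; nondegeneracy of `g` concludes. -/
theorem eulerOn_sprayCoeff (h : IsLocalFinsler U f) : EulerOn 2 (sprayCoeff f) (slit U) := by
  intro z hz
  rw [← sub_eq_zero]
  refine h.nondegenerate z hz _ fun X => ?_
  have hO := h.isOpen_slit
  have hE := h.contDiffOn_energy
  have hX : ContDiffOn ℝ ∞ (fun w => fderiv ℝ (energy f) w (0, X)) (slit U) :=
    contDiffOn_fderiv_apply hO hE contDiffOn_const
  have eX := h.eulerOn_energy.fderiv_vertical hO hE X
  have h1 : ∀ w ∈ slit U, fderiv ℝ (fun w => fderiv ℝ (energy f) w (0, X)) w (spray f w) =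
      fderiv ℝ (energy f) w (X, 0) := fun w hw => by
    rw [fderiv_fderiv_const hO hE hw, h.hessian_spray hw]
  have h2 := congrArg (fun L : Model n × Model n →L[ℝ] ℝ => L (0, z.2))
    (fderiv_congr_of_isOpen hO h1 hz)
  have hs := differentiableAt_of_contDiffOn hO h.contDiffOn_spray hz
  have h3 : fderiv ℝ (spray f) z (0, z.2) = (z.2, fderiv ℝ (sprayCoeff f) z (0, z.2)) := by
    have h4 : ∀ w ∈ slit U, spray f w = (w.2, sprayCoeff f w) := fun w hw => h.spray_eq hw
    rw [fderiv_congr_of_isOpen hO h4 hz, (hasFDerivAt_snd.prodMk (differentiableAt_of_contDiffOn hO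
      h.contDiffOn_sprayCoeff hz).hasFDerivAt).fderiv]
    rfl
  have h5 := h.eulerOn_energy.fderiv_horizontal hO hE X z hz
  have h6 := eX.fderiv_apply hO hX (spray f z).1 (spray f z).2 hz
  rw [Prod.mk.eta] at h6
  rw [fderiv_fderiv_apply hO hX hz hs, h5, h6, h3] at h2
  beta_reduce at h2
  rw [← h1 z hz, h.spray_eq hz] at h2
  have key : ∀ A B : Model n, fderiv ℝ (fun w => fderiv ℝ (energy f) w (0, X)) z (A, B) =
      fderiv ℝ (fun w => fderiv ℝ (energy f) w (0, X)) z (A, 0) + metric f z B X := fun A B => by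
    rw [h.metric_eq hz, ← map_add]; simp
  rw [key z.2, key z.2 (fderiv ℝ _ _ _), key 0] at h2
  have hl : metric f z (fderiv ℝ (sprayCoeff f) z (0, z.2) - (2 : ℝ) • sprayCoeff f z) X =
      metric f z (fderiv ℝ (sprayCoeff f) z (0, z.2)) X - 2 * metric f z (sprayCoeff f z) X := by
    have h7 : ((0 : Model n), fderiv ℝ (sprayCoeff f) z (0, z.2) - (2 : ℝ) • sprayCoeff f z) =
      (0, fderiv ℝ (sprayCoeff f) z (0, z.2)) - (2 : ℝ) • (0, sprayCoeff f z) := by simp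
    rw [h.metric_eq hz, h.metric_eq hz, h.metric_eq hz, h7, map_sub, map_smul, smul_eq_mul]
  have h0 : ((0 : Model n), (0 : Model n)) = 0 := rfl
  rw [hl]
  simp only [smul_eq_mul, h0, map_zero] at h2
  linarith

end IsLocalFinsler

section Prod

variable {V W₁ W₂ : Type*} [NormedAddCommGroup V] [NormedSpace ℝ V] [NormedAddCommGroup W₁]
  [NormedSpace ℝ W₁] [NormedAddCommGroup W₂] [NormedSpace ℝ W₂] {Ω : Set V}

theorem fderiv_prod_apply_of_isOpen (hΩ : IsOpen Ω) {g : V → W₁ × W₂} {a : V → W₁} {b : V → W₂}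
    (ha : ContDiffOn ℝ ∞ a Ω) (hb : ContDiffOn ℝ ∞ b Ω) (hg : ∀ w ∈ Ω, g w = (a w, b w)) {z : V}
    (hz : z ∈ Ω) (v : V) : fderiv ℝ g z v = (fderiv ℝ a z v, fderiv ℝ b z v) := by
  rw [fderiv_congr_of_isOpen hΩ hg hz, ((differentiableAt_of_contDiffOn hΩ ha
    hz).hasFDerivAt.prodMk (differentiableAt_of_contDiffOn hΩ hb hz).hasFDerivAt).fderiv]
  rfl

end Prod

namespace IsLocalFinsler

variable {U : Set (Model n)} {f : Model n × Model n → ℝ} {z : Model n × Model n}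

/-! ### The Berwald derivative -/

theorem hor_eq (h : IsLocalFinsler U f) (hz : z ∈ slit U) (X : Model n) :
    hor f z X = (X, (1 / 2 : ℝ) • fderiv ℝ (sprayCoeff f) z (0, X)) := by
  have h1 := fderiv_prod_apply_of_isOpen h.isOpen_slit contDiffOn_snd h.contDiffOn_sprayCoeff
    (fun w hw => h.spray_eq hw) hz (0, X)
  have h2 : fderiv ℝ (vertLift fun _ : Model n × Model n => X) z = 0 :=
    (hasFDerivAt_const ((0 : Model n), X) z).fderiv
  rw [hor, lieBracket, h2]
  simp only [vertLift, zero_apply, sub_zero]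
  rw [h1, fderiv_snd]
  ext1
  · simp only [ContinuousLinearMap.coe_snd', Prod.mk_add_mk, Prod.smul_mk, ← two_smul ℝ X,
      smul_smul]
    norm_num
  · simp

theorem vert_eq (h : IsLocalFinsler U f) (hz : z ∈ slit U) (ξ : Model n × Model n) :
    vert f z ξ = ξ.2 - (1 / 2 : ℝ) • fderiv ℝ (sprayCoeff f) z (0, ξ.1) := by
  rw [vert, h.hor_eq hz, Prod.snd_sub]

theorem contDiffOn_half_fderiv_sprayCoeff (h : IsLocalFinsler U f)
    {a : Model n × Model n → Model n} (ha : ContDiffOn ℝ ∞ a (slit U)) :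
    ContDiffOn ℝ ∞ (fun w => (1 / 2 : ℝ) • fderiv ℝ (sprayCoeff f) w (0, a w)) (slit U) :=
  (contDiffOn_fderiv_apply h.isOpen_slit h.contDiffOn_sprayCoeff
    (contDiffOn_const.prodMk ha)).const_smul _

theorem contDiffOn_horLift (h : IsLocalFinsler U f) {a : Model n × Model n → Model n}
    (ha : ContDiffOn ℝ ∞ a (slit U)) : ContDiffOn ℝ ∞ (horLift f a) (slit U) :=
  (ha.prodMk (h.contDiffOn_half_fderiv_sprayCoeff ha)).congr fun _ hw => h.hor_eq hw _

/-- Only the value of `ξ` at `z` survives: the derivatives of its horizontal component that arise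
from the bracket `[𝐡 ξ, 𝐢 Y]` are cancelled by `𝒱`. -/
theorem nabla_eq (h : IsLocalFinsler U f) (hz : z ∈ slit U)
    {ξ : Model n × Model n → Model n × Model n} (hξ : ContDiffOn ℝ ∞ ξ (slit U))
    {Y : Model n × Model n → Model n} (hY : ContDiffOn ℝ ∞ Y (slit U)) :
    nabla f ξ Y z = fderiv ℝ Y z (ξ z) -
      (1 / 2 : ℝ) • fderiv ℝ (fun w => fderiv ℝ (sprayCoeff f) w (0, (ξ z).1)) z (0, Y z) := by
  have hO := h.isOpen_slit
  have hH := h.contDiffOn_sprayCoeff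
  have hξ₁ : ContDiffOn ℝ ∞ (fun w => (ξ w).1) (slit U) := contDiff_fst.comp_contDiffOn hξ
  have hξ₂ : ContDiffOn ℝ ∞ (fun w => (ξ w).2) (slit U) := contDiff_snd.comp_contDiffOn hξ
  have hK := h.contDiffOn_half_fderiv_sprayCoeff hξ₁
  have h1 := fderiv_prod_apply_of_isOpen (g := horLift f Y) hO hY
    (h.contDiffOn_half_fderiv_sprayCoeff hY) (fun w hw => h.hor_eq hw _) hz
  have h2 := fderiv_prod_apply_of_isOpen (g := fun w => ξ w - hor f w (ξ w).1) hO
    (contDiffOn_const (c := (0 : Model n))) (hξ₂.sub hK)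
    (fun w hw => by rw [h.hor_eq hw]; ext1 <;> simp) hz
  have h3 := fderiv_prod_apply_of_isOpen (g := fun w => hor f w (ξ w).1) hO hξ₁ hK
    (fun w hw => h.hor_eq hw _) hz
  have h4 := fderiv_prod_apply_of_isOpen (g := vertLift Y) hO (contDiffOn_const (c := (0 : Model n)))
    hY (fun w _ => rfl) hz
  have h5 : DifferentiableAt ℝ (fun w => ((0 : Model n), (ξ w).1)) z :=
    differentiableAt_of_contDiffOn hO (contDiffOn_const.prodMk hξ₁) hz
  have h6 := fderiv_fderiv_apply hO hH hz h5 (0, Y z)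
  have h7 := fderiv_prod_apply_of_isOpen (g := fun w => ((0 : Model n), (ξ w).1)) hO
    (contDiffOn_const (c := (0 : Model n))) hξ₁ (fun w _ => rfl) hz (0, Y z)
  have h8 : fderiv ℝ (fun w => (1 / 2 : ℝ) • fderiv ℝ (sprayCoeff f) w (0, (ξ w).1)) z (0, Y z) =
      (1 / 2 : ℝ) • fderiv ℝ (fun w => fderiv ℝ (sprayCoeff f) w (0, (ξ w).1)) z (0, Y z) := by
    rw [fderiv_fun_const_smul (differentiableAt_of_contDiffOn hO
      (contDiffOn_fderiv_apply hO hH (contDiffOn_const.prodMk hξ₁)) hz)]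
    rfl
  have h9 : fderiv ℝ Y z (ξ z) =
      fderiv ℝ Y z (ξ z - hor f z (ξ z).1) + fderiv ℝ Y z (hor f z (ξ z).1) := by
    rw [← map_add, sub_add_cancel]
  have h10 : ∀ a : Model n, fderiv ℝ (sprayCoeff f) z (0, -a) =
      -fderiv ℝ (sprayCoeff f) z (0, a) := fun a => by
    rw [← map_neg]; simp
  rw [nabla, h.vert_eq hz, lieBracket, lieBracket, h1, h2, h3, h4, h9]
  simp only [Prod.snd_sub, Prod.fst_sub, vertLift, h8, h6, h7, fderiv_fun_const,
    Pi.zero_apply, zero_apply, zero_sub, sub_zero, h10, smul_add, smul_neg]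
  abel

theorem nabla_horLift_const (h : IsLocalFinsler U f) (hz : z ∈ slit U) (X Y : Model n) :
    nabla f (horLift f fun _ => X) (fun _ => Y) z =
      -((1 / 2 : ℝ) • fderiv ℝ (fun w => fderiv ℝ (sprayCoeff f) w (0, X)) z (0, Y)) := by
  rw [h.nabla_eq hz (h.contDiffOn_horLift contDiffOn_const) contDiffOn_const]
  simp [horLift, h.hor_eq hz]

theorem nabla_of_fst_eq_zero (h : IsLocalFinsler U f) (hz : z ∈ slit U)
    {ξ : Model n × Model n → Model n × Model n} (hξ : ContDiffOn ℝ ∞ ξ (slit U))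
    (h0 : (ξ z).1 = 0) {Y : Model n × Model n → Model n} (hY : ContDiffOn ℝ ∞ Y (slit U)) :
    nabla f ξ Y z = fderiv ℝ Y z (ξ z) := by
  have h00 : ((0 : Model n), (0 : Model n)) = 0 := rfl
  rw [h.nabla_eq hz hξ hY, h0]
  simp [h00]

/-! ### The Berwald curvature -/

theorem contDiffOn_fderiv_fderiv_sprayCoeff (h : IsLocalFinsler U f) (Y Z : Model n) :
    ContDiffOn ℝ ∞
      (fun w => fderiv ℝ (fun u => fderiv ℝ (sprayCoeff f) u (0, Y)) w (0, Z)) (slit U) :=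
  contDiffOn_fderiv_apply h.isOpen_slit (contDiffOn_fderiv_apply h.isOpen_slit
    h.contDiffOn_sprayCoeff contDiffOn_const) contDiffOn_const

/-- For constant sections only the first curvature term survives: `∇` of a constant section in a
vertical direction is zero, and `[𝐢 X, ℋ Y]` is vertical. -/
theorem berwald_eq (h : IsLocalFinsler U f) (hz : z ∈ slit U) (X Y Z : Model n) :
    berwald f z X Y Z = -((1 / 2 : ℝ) • fderiv ℝ
      (fun w => fderiv ℝ (fun u => fderiv ℝ (sprayCoeff f) u (0, Y)) w (0, Z)) z (0, X)) := by
  have hO := h.isOpen_slit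
  have hv : ContDiffOn ℝ ∞ (vertLift fun _ : Model n × Model n => X) (slit U) :=
    contDiffOn_const (c := ((0 : Model n), X))
  have hh : ContDiffOn ℝ ∞ (horLift f fun _ => Y) (slit U) := h.contDiffOn_horLift contDiffOn_const
  have hQ := h.contDiffOn_fderiv_fderiv_sprayCoeff Y Z
  have e1 : ∀ w ∈ slit U, nabla f (horLift f fun _ => Y) (fun _ => Z) w = -((1 / 2 : ℝ) •
      fderiv ℝ (fun u => fderiv ℝ (sprayCoeff f) u (0, Y)) w (0, Z)) :=
    fun w hw => h.nabla_horLift_const hw Y Z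
  have e2 : ∀ w ∈ slit U, nabla f (vertLift fun _ => X) (fun _ => Z) w = 0 := fun w hw => by
    rw [h.nabla_of_fst_eq_zero hw hv rfl contDiffOn_const]; simp
  have e3 : ∀ w ∈ slit U, lieBracket ℝ (vertLift fun _ => X) (horLift f fun _ => Y) w =
      (0, (1 / 2 : ℝ) • fderiv ℝ (fun u => fderiv ℝ (sprayCoeff f) u (0, Y)) w (0, X)) := by
    intro w hw
    have h1 := fderiv_prod_apply_of_isOpen (g := horLift f fun _ => Y) hO (contDiffOn_const (c := Y))
      (h.contDiffOn_half_fderiv_sprayCoeff contDiffOn_const) (fun w hw => h.hor_eq hw _) hw (0, X)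
    have h2 : fderiv ℝ (vertLift fun _ : Model n × Model n => X) w = 0 :=
      (hasFDerivAt_const ((0 : Model n), X) w).fderiv
    rw [lieBracket, h2]
    simp only [vertLift]
    rw [h1, fderiv_fun_const_smul (differentiableAt_of_contDiffOn hO
      (contDiffOn_fderiv_apply hO h.contDiffOn_sprayCoeff contDiffOn_const) hw)]
    simp
  have t1 : nabla f (vertLift fun _ => X) (nabla f (horLift f fun _ => Y) fun _ => Z) z =
      -((1 / 2 : ℝ) • fderiv ℝ
      (fun w => fderiv ℝ (fun u => fderiv ℝ (sprayCoeff f) u (0, Y)) w (0, Z)) z (0, X)) := by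
    rw [h.nabla_of_fst_eq_zero hz hv rfl ((hQ.const_smul (1 / 2 : ℝ)).neg.congr e1),
      fderiv_congr_of_isOpen hO e1 hz, fderiv_fun_neg,
      fderiv_fun_const_smul (differentiableAt_of_contDiffOn hO hQ hz)]
    rfl
  have t2 : nabla f (horLift f fun _ => Y) (nabla f (vertLift fun _ => X) fun _ => Z) z = 0 := by
    have h00 : ((0 : Model n), (0 : Model n)) = 0 := rfl
    rw [h.nabla_eq hz hh (contDiffOn_const.congr e2), fderiv_congr_of_isOpen hO e2 hz, e2 z hz]
    simp [h00]
  have t3 : nabla f (lieBracket ℝ (vertLift fun _ => X) (horLift f fun _ => Y)) (fun _ => Z) z =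
      0 := by
    rw [h.nabla_of_fst_eq_zero hz ((contDiffOn_const.prodMk
      ((h.contDiffOn_fderiv_fderiv_sprayCoeff Y X).const_smul _)).congr e3) (by rw [e3 z hz])
      contDiffOn_const]
    simp
  rw [berwald, t1, t2, t3, sub_zero, sub_zero]

theorem contDiffOn_berwald (h : IsLocalFinsler U f) (X Y Z : Model n) :
    ContDiffOn ℝ ∞ (fun w => berwald f w X Y Z) (slit U) :=
  ((contDiffOn_fderiv_apply h.isOpen_slit (h.contDiffOn_fderiv_fderiv_sprayCoeff Y Z)
    contDiffOn_const).const_smul (1 / 2 : ℝ)).neg.congr fun _ hw => h.berwald_eq hw X Y Z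

theorem berwald_right_comm (h : IsLocalFinsler U f) (hz : z ∈ slit U) (X Y Z : Model n) :
    berwald f z X Y Z = berwald f z X Z Y := by
  rw [h.berwald_eq hz, h.berwald_eq hz, fderiv_congr_of_isOpen h.isOpen_slit
    (fun w hw => fderiv_fderiv_comm h.isOpen_slit h.contDiffOn_sprayCoeff hw _ _) hz]

theorem berwald_swap (h : IsLocalFinsler U f) (hz : z ∈ slit U) (X Y Z : Model n) :
    berwald f z X Y Z = berwald f z Z Y X := by
  rw [h.berwald_eq hz, h.berwald_eq hz, fderiv_fderiv_comm h.isOpen_slit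
    (contDiffOn_fderiv_apply h.isOpen_slit h.contDiffOn_sprayCoeff contDiffOn_const) hz]

theorem berwald_left_comm (h : IsLocalFinsler U f) (hz : z ∈ slit U) (X Y Z : Model n) :
    berwald f z X Y Z = berwald f z Y X Z := by
  rw [h.berwald_right_comm hz, h.berwald_swap hz, h.berwald_right_comm hz]

/-- Second vertical derivatives of the spray coefficient are homogeneous of degree 0, so Euler's
relation annihilates them. -/
theorem berwald_direction (h : IsLocalFinsler U f) (hz : z ∈ slit U) (Y Z : Model n) :
    berwald f z z.2 Y Z = 0 := by
  have h1 := (h.eulerOn_sprayCoeff.fderiv_vertical h.isOpen_slit h.contDiffOn_sprayCoeff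
    Y).fderiv_vertical h.isOpen_slit (contDiffOn_fderiv_apply h.isOpen_slit
    h.contDiffOn_sprayCoeff contDiffOn_const) Z z hz
  rw [h.berwald_eq hz, h1]
  norm_num

theorem berwald_sub_smul (h : IsLocalFinsler U f) (hz : z ∈ slit U) (a : ℝ) (X Y Z : Model n) :
    berwald f z (X - a • z.2) Y Z = berwald f z X Y Z := by
  have h1 : ((0 : Model n), X - a • z.2) = (0, X) - a • (0, z.2) := by simp
  have h2 : berwald f z (X - a • z.2) Y Z = berwald f z X Y Z - a • berwald f z z.2 Y Z := by
    simp only [h.berwald_eq hz, h1, map_sub, map_smul, smul_sub, smul_neg,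
      smul_comm a (1 / 2 : ℝ)]
    abel
  rw [h2, h.berwald_direction hz, smul_zero, sub_zero]

theorem berwald_proj (h : IsLocalFinsler U f) (hz : z ∈ slit U) (X Y Z : Model n) :
    berwald f z (proj f z X) (proj f z Y) (proj f z Z) = berwald f z X Y Z := by
  simp only [proj]
  rw [h.berwald_sub_smul hz, h.berwald_left_comm hz, h.berwald_sub_smul hz, h.berwald_swap hz,
    h.berwald_sub_smul hz, h.berwald_right_comm hz, h.berwald_swap hz]

/-- Both sides are fourth vertical derivatives of the spray coefficient. This is the integrability
condition that forces `B = 0` when `B` is proportional to `δ`. -/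
theorem fderiv_berwald_comm (h : IsLocalFinsler U f) (hz : z ∈ slit U) (V X Y Z : Model n) :
    fderiv ℝ (fun w => berwald f w X Y Z) z (0, V) =
      fderiv ℝ (fun w => berwald f w V Y Z) z (0, X) := by
  have hQ := h.contDiffOn_fderiv_fderiv_sprayCoeff Y Z
  have h1 : ∀ A C : Model n, fderiv ℝ (fun w => berwald f w A Y Z) z (0, C) =
      -((1 / 2 : ℝ) • fderiv ℝ (fun v => fderiv ℝ (fun w => fderiv ℝ
        (fun u => fderiv ℝ (sprayCoeff f) u (0, Y)) w (0, Z)) v (0, A)) z (0, C)) := fun A C => by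
    rw [fderiv_congr_of_isOpen h.isOpen_slit (fun w hw => h.berwald_eq hw A Y Z) hz,
      fderiv_fun_neg, fderiv_fun_const_smul (differentiableAt_of_contDiffOn h.isOpen_slit
        (contDiffOn_fderiv_apply h.isOpen_slit hQ contDiffOn_const) hz)]
    rfl
  rw [h1, h1, fderiv_fderiv_comm h.isOpen_slit hQ hz]

end IsLocalFinsler

namespace IsLocalFinsler

variable {U : Set (Model n)} {f : Model n × Model n → ℝ} {z : Model n × Model n}

/-! ### The Landsberg tensor -/

/-- The energy is constant along horizontal vector fields. -/
theorem fderiv_energy_hor (h : IsLocalFinsler U f) (hz : z ∈ slit U) (X : Model n) :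
    fderiv ℝ (energy f) z (X, (1 / 2 : ℝ) • fderiv ℝ (sprayCoeff f) z (0, X)) = 0 := by
  have hO := h.isOpen_slit
  have hE := h.contDiffOn_energy
  -- Differentiate `dE(S) = 0` along `(0, X)`: by the Euler–Lagrange equation the result is `dE(2 ℋ
  -- X) = 0`.
  have h1 := fderiv_fderiv_apply hO hE hz
    (differentiableAt_of_contDiffOn hO h.contDiffOn_spray hz) (0, X)
  rw [fderiv_congr_of_isOpen hO (fun w hw => h.fderiv_energy_spray hw) hz,
    fderiv_fderiv_const hO hE hz, h.hessian_comm hz, h.hessian_spray hz,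
    fderiv_prod_apply_of_isOpen hO contDiffOn_snd h.contDiffOn_sprayCoeff
      (fun w hw => h.spray_eq hw) hz, fderiv_snd, ← map_add] at h1
  have h2 : ((X, 0) : Model n × Model n) +
      (ContinuousLinearMap.snd ℝ (Model n) (Model n) (0, X),
        fderiv ℝ (sprayCoeff f) z (0, X)) =
      (2 : ℝ) • (X, (1 / 2 : ℝ) • fderiv ℝ (sprayCoeff f) z (0, X)) := by
    ext1
    · simp [two_smul]
    · simp
  rw [h2, map_smul] at h1
  simpa using h1.symm

theorem metric_neg_left (h : IsLocalFinsler U f) (hz : z ∈ slit U) (X Y : Model n) :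
    metric f z (-X) Y = -metric f z X Y := by
  have h1 : ((0 : Model n), -X) = -(0, X) := by simp
  rw [h.metric_eq hz, h.metric_eq hz, h1, map_neg]

theorem fderiv_energy_hor_vertical (h : IsLocalFinsler U f) (hz : z ∈ slit U) (X Y : Model n) :
    fderiv ℝ (fun w => fderiv ℝ (energy f) w (0, Y)) z
        (X, (1 / 2 : ℝ) • fderiv ℝ (sprayCoeff f) z (0, X)) +
      fderiv ℝ (energy f) z (0, (1 / 2 : ℝ) •
        fderiv ℝ (fun w => fderiv ℝ (sprayCoeff f) w (0, X)) z (0, Y)) = 0 := by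
  have hO := h.isOpen_slit
  have hE := h.contDiffOn_energy
  have hK := h.contDiffOn_half_fderiv_sprayCoeff (contDiffOn_const (c := X))
  have hξ : ContDiffOn ℝ ∞ (fun w => (X, (1 / 2 : ℝ) • fderiv ℝ (sprayCoeff f) w (0, X)))
    (slit U) := contDiffOn_const.prodMk hK
  have h1 := fderiv_fderiv_apply hO hE hz (differentiableAt_of_contDiffOn hO hξ hz) (0, Y)
  rw [fderiv_congr_of_isOpen hO (fun w hw => h.fderiv_energy_hor hw X) hz,
    fderiv_fderiv_comm hO hE hz, fderiv_prod_apply_of_isOpen hO (contDiffOn_const (c := X)) hK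
      (fun w _ => rfl) hz, fderiv_fun_const_smul (differentiableAt_of_contDiffOn hO
      (contDiffOn_fderiv_apply hO h.contDiffOn_sprayCoeff contDiffOn_const) hz)] at h1
  simpa using h1.symm

/-- Differentiate `dE(ℋ X) = 0` vertically along `Y` and then `Z`. The second-order terms in the
spray coefficient complete the derivative of `g(Y, Z)` along `ℋ X` to `(∇_{ℋ X} g)(Y, Z)`; the
third-order term is `-g(B(X, Y)Z, δ)`. -/
theorem metric_berwald_direction (h : IsLocalFinsler U f) (hz : z ∈ slit U) (X Y Z : Model n) :
    metric f z (berwald f z X Y Z) z.2 = -2 * landsberg f z X Y Z := by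
  have hO := h.isOpen_slit
  have hE := h.contDiffOn_energy
  have hK := h.contDiffOn_half_fderiv_sprayCoeff (contDiffOn_const (c := X))
  have hξ : ContDiffOn ℝ ∞ (fun w => (X, (1 / 2 : ℝ) • fderiv ℝ (sprayCoeff f) w (0, X)))
    (slit U) := contDiffOn_const.prodMk hK
  have hY : ContDiffOn ℝ ∞ (fun w => fderiv ℝ (energy f) w (0, Y)) (slit U) :=
    contDiffOn_fderiv_apply hO hE contDiffOn_const
  have hQ := h.contDiffOn_fderiv_fderiv_sprayCoeff X Y
  have hq := hQ.const_smul (1 / 2 : ℝ)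
  have hζ : ContDiffOn ℝ ∞ (fun w => ((0 : Model n), (1 / 2 : ℝ) •
    fderiv ℝ (fun u => fderiv ℝ (sprayCoeff f) u (0, X)) w (0, Y))) (slit U) :=
    contDiffOn_const.prodMk hq
  have h1 : fderiv ℝ (fun w => fderiv ℝ (fun u => fderiv ℝ (energy f) u (0, Y)) w
        (X, (1 / 2 : ℝ) • fderiv ℝ (sprayCoeff f) w (0, X))) z (0, Z) +
      fderiv ℝ (fun w => fderiv ℝ (energy f) w (0, (1 / 2 : ℝ) •
        fderiv ℝ (fun u => fderiv ℝ (sprayCoeff f) u (0, X)) w (0, Y))) z (0, Z) = 0 := by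
    have h2 := fderiv_congr_of_isOpen hO (fun w hw => h.fderiv_energy_hor_vertical hw X Y) hz
    rw [fderiv_fun_add
      (differentiableAt_of_contDiffOn hO (contDiffOn_fderiv_apply hO hY hξ) hz)
      (differentiableAt_of_contDiffOn hO (contDiffOn_fderiv_apply hO hE hζ) hz)] at h2
    simpa using congrArg (fun L : Model n × Model n →L[ℝ] ℝ => L (0, Z)) h2
  have h3 := fderiv_prod_apply_of_isOpen hO (contDiffOn_const (c := X)) hK (fun w _ => rfl) hz
    (0, Z)
  have h4 := fderiv_prod_apply_of_isOpen hO (contDiffOn_const (c := (0 : Model n))) hq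
    (fun w _ => rfl) hz (0, Z)
  have h5 := fderiv_fderiv_apply hO hY hz (differentiableAt_of_contDiffOn hO hξ hz) (0, Z)
  have h6 := fderiv_fderiv_apply hO hE hz (differentiableAt_of_contDiffOn hO hζ hz) (0, Z)
  rw [h3, fderiv_fderiv_comm hO hY hz, fderiv_fun_const_smul (differentiableAt_of_contDiffOn hO
      (contDiffOn_fderiv_apply hO h.contDiffOn_sprayCoeff contDiffOn_const) hz)] at h5
  have h7 : fderiv ℝ (fun w => fderiv ℝ (fun u => fderiv ℝ (energy f) u (0, Y)) w (0, Z)) z =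
      fderiv ℝ (fun w => metric f w Y Z) z :=
    fderiv_congr_of_isOpen hO (fun w hw => by rw [h.metric_comm hw, h.metric_eq hw]) hz
  rw [h4, fderiv_fderiv_comm hO hE hz,
    fderiv_fun_const_smul (differentiableAt_of_contDiffOn hO hQ hz)] at h6
  have h8 : fderiv ℝ (fun w => metric f w Y Z) z (hor f z X) -
      metric f z (nabla f (horLift f fun _ => X) (fun _ => Z) z) Y -
      metric f z (nabla f (horLift f fun _ => X) (fun _ => Y) z) Z =
      metric f z (berwald f z Z X Y) z.2 := by
    rw [h.nabla_horLift_const hz, h.nabla_horLift_const hz, h.berwald_eq hz, h.metric_neg_left hz,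
      h.metric_neg_left hz, h.metric_neg_left hz, h.metric_direction hz, h.metric_eq hz,
      h.metric_eq hz, h.hor_eq hz, ← h7]
    simp only [fderiv_fun_const, Pi.zero_apply, zero_apply, smul_apply] at h5 h6
    rw [h5, h6] at h1
    linarith
  rw [landsberg, nablaTensor, h.berwald_swap hz X Y Z, h.berwald_right_comm hz Z Y X,
    h.metric_comm hz Y, ← h8]
  simp only [horLift]
  ring

theorem proj_zero (h : IsLocalFinsler U f) (hz : z ∈ slit U) : proj f z 0 = 0 := by
  have h0 : ((0 : Model n), (0 : Model n)) = 0 := rfl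
  rw [proj, h.metric_eq hz, h0, map_zero, zero_div, zero_smul, sub_zero]

theorem projBerwald_eq (h : IsLocalFinsler U f) (hz : z ∈ slit U) (X Y Z : Model n) :
    projBerwald f z X Y Z =
      berwald f z X Y Z + ((1 / energy f z) * landsberg f z X Y Z) • z.2 := by
  have h0 := h.energy_ne_zero hz
  rw [projBerwald, h.berwald_proj hz, proj, h.metric_berwald_direction hz,
    h.metric_direction_direction hz, sub_eq_add_neg, ← neg_smul]
  congr 2
  field_simp

/-! ### Vanishing of the Berwald curvature -/

theorem berwald_eq_zero_of_projBerwald_eq_zero (h : IsLocalFinsler U f) (hn : 3 ≤ n)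
    (hP : ∀ z ∈ slit U, ∀ X Y Z, projBerwald f z X Y Z = 0) (hz : z ∈ slit U) (X Y Z : Model n) :
    berwald f z X Y Z = 0 := by
  have hB : ∀ w ∈ slit U, ∀ X, ∃ c : ℝ, berwald f w X Y Z = c • w.2 := fun w hw X =>
    ⟨-((1 / energy f w) * landsberg f w X Y Z), by
      rw [neg_smul, ← add_eq_zero_iff_eq_neg, ← h.projBerwald_eq hw, hP w hw]⟩
  -- The dimension hypothesis enters here: two vectors cannot span a space of dimension at least 3.
  obtain ⟨V, hV⟩ : ∃ V, V ∉ Submodule.span ℝ (({z.2, X} : Finset (Model n)) : Set (Model n)) := by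
    by_contra! hall
    have h1 := finrank_span_finset_le_card (R := ℝ) ({z.2, X} : Finset (Model n))
    rw [Set.finrank, (Submodule.eq_top_iff'.2 hall), finrank_top, finrank_euclideanSpace_fin] at h1
    have := h1.trans Finset.card_le_two
    omega
  obtain ⟨l, hlV, hl⟩ := Submodule.exists_dual_map_eq_bot_of_notMem hV inferInstance
  have hl0 : ∀ v ∈ ({z.2, X} : Finset (Model n)), l v = 0 := fun v hv => by
    have := Submodule.mem_map_of_mem (f := l) (Submodule.subset_span (R := ℝ) hv)
    rwa [hl, Submodule.mem_bot] at this
  have hly : l z.2 = 0 := hl0 _ (by simp)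
  have hlX : l X = 0 := hl0 _ (by simp)
  let L : Model n →L[ℝ] ℝ := LinearMap.toContinuousLinearMap l
  have key : ∀ (e : Model n →L[ℝ] ℝ) (A C : Model n),
      e z.2 * L (fderiv ℝ (fun w => berwald f w A Y Z) z (0, C)) =
        L C * e (berwald f z A Y Z) := by
    intro e A C
    -- Proportionality of `B` to `y` in cross-multiplied form, so that the coefficient `c` need not
    -- be differentiated.
    have h1 : ∀ w ∈ slit U, e w.2 * L (berwald f w A Y Z) = L w.2 * e (berwald f w A Y Z) := by
      intro w hw
      obtain ⟨c, hc⟩ := hB w hw A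
      rw [hc, map_smul, map_smul, smul_eq_mul, smul_eq_mul]
      ring
    have hb := (differentiableAt_of_contDiffOn h.isOpen_slit (h.contDiffOn_berwald A Y Z)
      hz).hasFDerivAt
    have h2 : ∀ φ : Model n →L[ℝ] ℝ, HasFDerivAt (fun w : Model n × Model n => φ w.2)
        (φ.comp (ContinuousLinearMap.snd ℝ (Model n) (Model n))) z :=
      fun φ => φ.hasFDerivAt.comp z hasFDerivAt_snd
    have h3 : ∀ φ : Model n →L[ℝ] ℝ, HasFDerivAt (fun w => φ (berwald f w A Y Z))
        (φ.comp (fderiv ℝ (fun w => berwald f w A Y Z) z)) z :=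
      fun φ => φ.hasFDerivAt.comp z hb
    have h4 := fderiv_congr_of_isOpen h.isOpen_slit h1 hz
    rw [((h2 e).fun_mul (h3 L)).fderiv, ((h2 L).fun_mul (h3 e)).fderiv] at h4
    have h5 := congrArg (fun M : Model n × Model n →L[ℝ] ℝ => M (0, C)) h4
    have hLy : L z.2 = 0 := hly
    have hLb : L (berwald f z A Y Z) = 0 := by
      obtain ⟨c, hc⟩ := hB z hz A
      rw [hc, map_smul, hLy, smul_zero]
    simp only [add_apply, smul_apply, ContinuousLinearMap.comp_apply,
      ContinuousLinearMap.coe_snd', smul_eq_mul, hLy, hLb, zero_mul, add_zero, zero_add] at h5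
    rw [h5, mul_comm]
  have hLX : L X = 0 := hlX
  have hfin : ∀ e : Model n →L[ℝ] ℝ, e (berwald f z X Y Z) = 0 := fun e => by
    have h1 := key e X V
    -- Exchanging `V` and `X` replaces the factor `L V ≠ 0` by `L X = 0`.
    rw [h.fderiv_berwald_comm hz, key e V X, hLX, zero_mul] at h1
    exact (mul_eq_zero.1 h1.symm).resolve_left hlV
  have := hfin (innerSL ℝ (berwald f z X Y Z))
  rwa [innerSL_apply_apply, inner_self_eq_zero] at this

theorem douglas_eq_berwald (h : IsLocalFinsler U f)
    (hT : ∀ z ∈ slit U, ∀ X Y, trBerwald f z X Y = 0) (hz : z ∈ slit U) (X Y Z : Model n) :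
    douglas f z X Y Z = berwald f z X Y Z := by
  rw [douglas, nablaTensor, fderiv_congr_of_isOpen h.isOpen_slit (fun w hw => hT w hw Y Z) hz]
  simp [hT z hz]

end IsLocalFinsler

/-! ### Finsler functions in charts -/

/-- Injectivity ensures that a direction `y ≠ 0` in the chart represents a nonzero tangent vector,
where `F` is known to be smooth. -/
theorem mfderiv_chart_symm_injective {M : Type*} [TopologicalSpace M] [ChartedSpace (Model n) M]
    {φ : OpenPartialHomeomorph M (Model n)}
    (hφ : φ ∈ IsManifold.maximalAtlas (𝓡 n) ∞ M) {x : Model n} (hx : x ∈ φ.target) :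
    Function.Injective (mfderiv (𝓡 n) (𝓡 n) φ.symm x) := by
  have hd : φ.MDifferentiable (𝓡 n) (𝓡 n) :=
    ⟨(contMDiffOn_of_mem_maximalAtlas hφ).mdifferentiableOn (by simp),
      (contMDiffOn_symm_of_mem_maximalAtlas hφ).mdifferentiableOn (by simp)⟩
  exact hd.symm.mfderiv_injective hx

theorem contDiffOn_chartExpr {M : Type*} [TopologicalSpace M] [ChartedSpace (Model n) M]
    [IsManifold (𝓡 n) ∞ M] {F : TangentBundle (𝓡 n) M → ℝ}
    (hF : ContMDiffOn (𝓡 n).tangent 𝓘(ℝ, ℝ) ∞ F {v : TangentBundle (𝓡 n) M | v.2 ≠ 0})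
    {φ : OpenPartialHomeomorph M (Model n)} (hφ : φ ∈ IsManifold.maximalAtlas (𝓡 n) ∞ M) :
    ContDiffOn ℝ ∞ (chartExpr F φ) (slit φ.target) := by
  have : IsManifold (𝓡 n) 1 M := IsManifold.of_le (n := ∞) (by simp)
  have h1 := (contMDiffOn_symm_of_mem_maximalAtlas hφ).contMDiffOn_tangentMapWithin (m := ∞)
    (by simp) φ.open_target.uniqueMDiffOn
  have h2 : ContMDiffOn ((𝓡 n).prod 𝓘(ℝ, Model n)) 𝓘(ℝ, ℝ) ∞
      (fun z : ModelProd (Model n) (Model n) => F (tangentMapWithin (𝓡 n) (𝓡 n) φ.symm φ.target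
        ((tangentBundleModelSpaceHomeomorph (𝓡 n)).symm z)))
      {z : Model n × Model n | z.1 ∈ φ.target ∧ z.2 ≠ 0} := by
    refine hF.comp (h1.comp contMDiff_tangentBundleModelSpaceHomeomorph_symm.contMDiffOn ?_) ?_
    · intro z hz; exact hz.1
    · intro z hz h0
      refine hz.2 (mfderiv_chart_symm_injective hφ hz.1 ?_)
      have h0' : mfderivWithin (𝓡 n) (𝓡 n) φ.symm φ.target z.1 z.2 = 0 := h0
      rw [mfderivWithin_of_mem_nhds (φ.open_target.mem_nhds hz.1)] at h0'
      exact h0'.trans (map_zero _).symm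
  have h3 : ContMDiffOn 𝓘(ℝ, Model n × Model n) 𝓘(ℝ, ℝ) ∞
      (fun z : Model n × Model n => F (tangentMapWithin (𝓡 n) (𝓡 n) φ.symm φ.target
        ((tangentBundleModelSpaceHomeomorph (𝓡 n)).symm z)))
      {z : Model n × Model n | z.1 ∈ φ.target ∧ z.2 ≠ 0} := by
    rw [modelWithCornersSelf_prod]
    exact h2
  -- On the open target of the chart the derivative within the target is the full derivative used in
  -- `chartExpr`.
  refine h3.contDiffOn.congr fun z hz => ?_
  have h4 := mfderivWithin_of_mem_nhds (I := 𝓡 n) (I' := 𝓡 n) (f := φ.symm)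
    (φ.open_target.mem_nhds hz.1)
  exact congrArg (fun L : TangentSpace (𝓡 n) z.1 →L[ℝ] TangentSpace (𝓡 n) (φ.symm z.1) =>
    F ⟨φ.symm z.1, L z.2⟩) h4.symm

theorem IsFinslerFunction.isLocalFinsler {M : Type*} [TopologicalSpace M]
    [ChartedSpace (Model n) M] [IsManifold (𝓡 n) ∞ M] {F : TangentBundle (𝓡 n) M → ℝ}
    (hF : IsFinslerFunction F) {φ : OpenPartialHomeomorph M (Model n)}
    (hφ : φ ∈ IsManifold.maximalAtlas (𝓡 n) ∞ M) : IsLocalFinsler φ.target (chartExpr F φ) where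
  isOpen := φ.open_target
  smooth := contDiffOn_chartExpr hF.smooth hφ
  homogeneous x _ y c hc := by
    have h1 : mfderiv (𝓡 n) (𝓡 n) φ.symm x (c • y) = c • mfderiv (𝓡 n) (𝓡 n) φ.symm x y :=
      map_smul _ c y
    refine Eq.trans ?_ (hF.homogeneous (φ.symm x) (mfderiv (𝓡 n) (𝓡 n) φ.symm x y) c hc)
    exact congrArg (fun v : TangentSpace (𝓡 n) (φ.symm x) =>
      F (⟨φ.symm x, v⟩ : TangentBundle (𝓡 n) M)) h1
  nondegenerate z hz := hF.nondegenerate φ hφ z.1 hz.1 z.2 hz.2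

end Finsler

end

/-! ### The three equivalences, read off chart by chart -/

theorem mainTheorem6 {n : ℕ} (hn : 3 ≤ n) {M : Type*} [TopologicalSpace M] [T2Space M]
    [SecondCountableTopology M] [ConnectedSpace M] [ChartedSpace (Finsler.Model n) M]
    [IsManifold (𝓡 n) ∞ M] (F : TangentBundle (𝓡 n) M → ℝ) (hF : Finsler.IsFinslerFunction F) :
    (Finsler.IsPBerwald F ↔
      Finsler.OnSlit F fun f z => ∀ X Y Z,
        Finsler.berwald f z X Y Z +
          ((1 / Finsler.energy f z) * Finsler.landsberg f z X Y Z) • z.2 = 0) ∧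
    (Finsler.IsPBerwald F ↔ Finsler.IsWeaklyBerwald F ∧ Finsler.IsDouglas F) ∧
    (Finsler.IsPBerwald F ↔ Finsler.IsBerwald F) := by
  have h3 : Finsler.IsPBerwald F ↔ Finsler.IsBerwald F := by
    refine ⟨fun h φ hφ x hx y hy X Y Z => ?_, fun h φ hφ x hx y hy X Y Z => ?_⟩
    · exact (hF.isLocalFinsler hφ).berwald_eq_zero_of_projBerwald_eq_zero hn
        (fun z hz => h φ hφ z.1 hz.1 z.2 hz.2) ⟨hx, hy⟩ X Y Z
    · rw [Finsler.projBerwald, (hF.isLocalFinsler hφ).berwald_proj ⟨hx, hy⟩,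
        h φ hφ x hx y hy X Y Z, (hF.isLocalFinsler hφ).proj_zero ⟨hx, hy⟩]
  refine ⟨⟨fun h φ hφ x hx y hy X Y Z => ?_, fun h φ hφ x hx y hy X Y Z => ?_⟩, h3.trans
    ⟨fun h => ?_, fun h φ hφ x hx y hy X Y Z => ?_⟩, h3⟩
  · rw [← (hF.isLocalFinsler hφ).projBerwald_eq ⟨hx, hy⟩]
    exact h φ hφ x hx y hy X Y Z
  · rw [(hF.isLocalFinsler hφ).projBerwald_eq ⟨hx, hy⟩]
    exact h φ hφ x hx y hy X Y Z
  · have hW : Finsler.IsWeaklyBerwald F := fun φ hφ x hx y hy X Y => by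
      simp [Finsler.trBerwald, h φ hφ x hx y hy]
    refine ⟨hW, fun φ hφ x hx y hy X Y Z => ?_⟩
    rw [(hF.isLocalFinsler hφ).douglas_eq_berwald (fun z hz => hW φ hφ z.1 hz.1 z.2 hz.2) ⟨hx, hy⟩]
    exact h φ hφ x hx y hy X Y Z
  · rw [← (hF.isLocalFinsler hφ).douglas_eq_berwald
      (fun z hz => h.1 φ hφ z.1 hz.1 z.2 hz.2) ⟨hx, hy⟩]
    exact h.2 φ hφ x hx y hy X Y Z
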